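/- For positive integers $m,n$, let $Y_{m,n}=\{(i,j): 1\le i\le m,\ 1\le j\le n\}$ be the rectangular Young diagram with $m$ rows and $n$ columns, and number each box by $\alpha_{m,n}(i,j)=\min\{j-i+m,\ i-j+n\}$. For a box $(i,j)$ of a Young diagram $Y$, the hook $h_Y(i,j)$ consists of $(i,j)$, the boxes of $Y$ below it in its column and the boxes of $Y$ to the right of it in its row; removing it means deleting these boxes and then moving each box $(i',j')$ with $i'>i$, $j'>j$ to $(i'-1,j'-1)$. For a hook $h$, let $\mathcal{A}(h)$ denote the multiset of the numbers $\alpha_{m,n}(b)$, $b\in h$. The Multiple Hook Removing Game $\mathrm{MHRG}(m,n)$ is the impartial game (the player making the last move wins) with starting position $Y_{m,n}$ in which a move from a Young diagram $Y\subseteq Y_{m,n}$ is made as follows: the player chooses a box of $Y$ and removes its hook $h$; then, as long as the current diagram has a box whose hook $h'$ satisfies $\mathcal{A}(h')=\mathcal{A}(h)$, the player must choose such a box and remove its hook; the turn ends when there is no such box. The $\mathcal{G}$-value of a position $G$ is defined recursively by $\mathcal{G}(G)=\mathrm{mex}\{\mathcal{G}(G') : G\to G'\}$, where $G\to G'$ means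 that $G'$ can be reached from $G$ by one move and $\mathrm{mex}\,T=\min(\mathbb{Z}_{\ge 0}\setminus T)$. Then for every integer $n\ge 1$, the $\mathcal{G}$-value of the starting position $Y_{n,n}$ of $\mathrm{MHRG}(n,n)$ and the $\mathcal{G}$-value of the starting position $Y_{n,n+1}$ of $\mathrm{MHRG}(n,n+1)$ are both equal to the nim-sum $1\oplus 2\oplus\cdots\oplus n$, i.e. \[ \mathcal{G}(Y_{n,n})=\mathcal{G}(Y_{n,n+1})=\bigoplus_{1\le k\le n} k, \] where $\oplus$ denotes addition of binary expansions without carry. -/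

import Mathlib

/-- A short impartial game with a starting position. Both players have the same moves; the player
who makes the last move wins. `Pos` is the set of game positions, and `Move p q` says that `q` is
an option of `p`. From each position only finitely many positions can be reached, and no position
can occur twice in a play. -/
structure ImpartialGame where
  Pos : Type
  Move : Pos → Pos → Prop
  start : Pos
  finite_reachable : ∀ p, {q | Relation.ReflTransGen Move p q}.Finite
  acyclic : ∀ p, ¬ Relation.TransGen Move p p

/-- The minimal excluded value `min (ℕ \ T)` of a proper subset `T` of `ℕ`. -/
noncomputable def mex (T : Set ℕ) : ℕ := sInf Tᶜ

namespace ImpartialGame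

theorem ncard_reachable_lt (G : ImpartialGame) {p q : G.Pos} (h : G.Move p q) :
    {r | Relation.ReflTransGen G.Move q r}.ncard <
      {r | Relation.ReflTransGen G.Move p r}.ncard := by
  refine Set.ncard_lt_ncard ⟨fun r hr => Relation.ReflTransGen.head h hr, fun hs => ?_⟩
    (G.finite_reachable p)
  have hqp : Relation.ReflTransGen G.Move q p :=
    hs (show p ∈ {r | Relation.ReflTransGen G.Move p r} from Relation.ReflTransGen.refl)
  exact G.acyclic p (Relation.TransGen.head' h hqp)

/-- The `𝒢`-value (Sprague–Grundy value) of a position: the mex of the `𝒢`-values of its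
options. -/
noncomputable def grundy (G : ImpartialGame) (p : G.Pos) : ℕ :=
  mex (Set.range fun q : {q : G.Pos // G.Move p q} => G.grundy q.1)
termination_by {r | Relation.ReflTransGen G.Move p r}.ncard
decreasing_by exact G.ncard_reachable_lt q.2

end ImpartialGame

namespace YoungDiagram

/-- The hook of the box `c` in `Y`: the box `c`, the boxes of `Y` below it in its column, and the
boxes of `Y` to the right of it in its row. Boxes are indexed from `(0, 0)`. -/
def hook (Y : YoungDiagram) (c : ℕ × ℕ) : Finset (ℕ × ℕ) :=
  Y.cells.filter fun b => b = c ∨ (c.1 < b.1 ∧ b.2 = c.2) ∨ (b.1 = c.1 ∧ c.2 < b.2)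

/-- The displacement of the boxes remaining after the removal of the hook of `c`: a box strictly
below and strictly to the right of `c` moves one step diagonally up-left, the others stay. -/
def hookShift (c b : ℕ × ℕ) : ℕ × ℕ :=
  if c.1 < b.1 ∧ c.2 < b.2 then (b.1 - 1, b.2 - 1) else b

/-- The Young diagram `Y \ h_Y(c)` obtained from `Y` by removing the hook of the box `c`. -/
def removeHook (Y : YoungDiagram) (c : ℕ × ℕ) : YoungDiagram where
  cells := (Y.cells \ Y.hook c).image (hookShift c)
  isLowerSet := by
    have key : ∀ a : ℕ × ℕ, a ∈ (Y.cells \ Y.hook c).image (hookShift c) ↔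
        (a ∈ Y ∧ (a.1 < c.1 ∨ a.2 < c.2)) ∨
          (c.1 ≤ a.1 ∧ c.2 ≤ a.2 ∧ (a.1 + 1, a.2 + 1) ∈ Y) := by
      rintro ⟨a1, a2⟩
      obtain ⟨c1, c2⟩ := c
      simp only [Finset.mem_image, Finset.mem_sdiff, hook, Finset.mem_filter, hookShift,
        YoungDiagram.mem_cells, Prod.exists, Prod.mk.injEq]
      constructor
      · rintro ⟨b1, b2, ⟨hb, hn⟩, he⟩
        split_ifs at he with h
        · simp only [Prod.mk.injEq] at he
          right
          have e1 : a1 + 1 = b1 := by omega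
          have e2 : a2 + 1 = b2 := by omega
          refine ⟨by omega, by omega, ?_⟩
          rw [e1, e2]; exact hb
        · simp only [Prod.mk.injEq] at he
          obtain ⟨rfl, rfl⟩ := he
          left
          refine ⟨hb, ?_⟩
          by_contra hc
          apply hn
          refine ⟨hb, ?_⟩
          omega
      · rintro (⟨ha, h⟩ | ⟨h1, h2, ha⟩)
        · refine ⟨a1, a2, ⟨ha, ?_⟩, ?_⟩
          · rintro ⟨-, h'⟩
            omega
          · rw [if_neg (by omega)]
        · refine ⟨a1 + 1, a2 + 1, ⟨ha, ?_⟩, ?_⟩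
          · rintro ⟨-, h'⟩
            omega
          · rw [if_pos (by omega)]; rfl
    intro a b hba ha
    rw [Finset.mem_coe, key] at ha ⊢
    obtain ⟨h1, h2⟩ := Prod.mk_le_mk.1 (show (b.1, b.2) ≤ (a.1, a.2) from hba)
    rcases ha with ⟨ha, h⟩ | ⟨ha1, ha2, ha⟩
    · exact Or.inl ⟨Y.up_left_mem h1 h2 ha, by omega⟩
    · by_cases hb : b.1 < c.1 ∨ b.2 < c.2
      · exact Or.inl ⟨Y.up_left_mem (by omega) (by omega) ha, hb⟩
      · exact Or.inr ⟨by omega, by omega, Y.up_left_mem (by omega) (by omega) ha⟩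

theorem hookShift_le (c b : ℕ × ℕ) : hookShift c b ≤ b := by
  unfold hookShift
  split_ifs
  · exact ⟨Nat.sub_le _ _, Nat.sub_le _ _⟩
  · exact le_rfl

theorem removeHook_lt (Y : YoungDiagram) {c : ℕ × ℕ} (hc : c ∈ Y) : Y.removeHook c < Y := by
  rw [← cells_ssubset_iff]
  refine (Finset.ssubset_iff_subset_ne).2 ⟨?_, fun he => ?_⟩
  · intro a ha
    obtain ⟨b, hb, rfl⟩ := Finset.mem_image.1 ha
    exact Y.isLowerSet (hookShift_le c b) (Finset.mem_sdiff.1 hb).1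
  · have h1 : (Y.removeHook c).cells.card ≤ (Y.cells \ Y.hook c).card := Finset.card_image_le
    have h2 : (Y.cells \ Y.hook c).card < Y.cells.card := by
      refine Finset.card_lt_card (Finset.ssubset_iff_subset_ne.2 ⟨Finset.sdiff_subset, ?_⟩)
      intro h
      have hc' : c ∈ Y.cells \ Y.hook c := by rw [h]; exact hc
      exact (Finset.mem_sdiff.1 hc').2 (Finset.mem_filter.2 ⟨hc, Or.inl rfl⟩)
    rw [he] at h1
    omega

/-- The multiset `𝒜(h_Y(c))` of the numbers in the boxes of the hook of `c`. -/
def hookNumbers (α : ℕ × ℕ → ℕ) (Y : YoungDiagram) (c : ℕ × ℕ) : Multiset ℕ :=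
  (Y.hook c).val.map α

/-- `Y.Forced α A Z`: starting from `Y`, one may end the turn at `Z` by removing, as long as there
is one, some hook whose multiset of numbers is `A`. -/
inductive Forced (α : ℕ × ℕ → ℕ) (A : Multiset ℕ) : YoungDiagram → YoungDiagram → Prop
  | done (Y : YoungDiagram) (h : ∀ c ∈ Y, hookNumbers α Y c ≠ A) : Forced α A Y Y
  | step (Y Z : YoungDiagram) (c : ℕ × ℕ) (hc : c ∈ Y) (hA : hookNumbers α Y c = A)
      (h : Forced α A (Y.removeHook c) Z) : Forced α A Y Z

/-- A move of the Multiple Hook Removing Game with numbering `α`: the player removes the hook of a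
box `c` of `Y`, and must then go on removing hooks with the same multiset of numbers as the first
one until there is none left. -/
def MHRGMove (α : ℕ × ℕ → ℕ) (Y Z : YoungDiagram) : Prop :=
  ∃ c ∈ Y, Forced α (hookNumbers α Y c) (Y.removeHook c) Z

theorem Forced.le {α : ℕ × ℕ → ℕ} {A : Multiset ℕ} {Y Z : YoungDiagram} (h : Forced α A Y Z) :
    Z ≤ Y := by
  induction h with
  | done Y _ => exact le_rfl
  | step Y Z c hc _ _ ih => exact ih.trans (Y.removeHook_lt hc).le

theorem MHRGMove.lt {α : ℕ × ℕ → ℕ} {Y Z : YoungDiagram} (h : MHRGMove α Y Z) : Z < Y := by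
  obtain ⟨c, hc, hf⟩ := h
  exact hf.le.trans_lt (Y.removeHook_lt hc)

theorem finite_Iic (Y : YoungDiagram) : (Set.Iic Y).Finite := by
  refine Set.Finite.of_finite_image (f := YoungDiagram.cells) ?_
    (fun a _ b _ h => YoungDiagram.ext h)
  refine (Finset.finite_toSet Y.cells.powerset).subset ?_
  rintro _ ⟨Z, hZ, rfl⟩
  exact Finset.mem_coe.2 (Finset.mem_powerset.2 (cells_subset_iff.2 hZ))

/-- The rectangular Young diagram with `m` rows and `n` columns. -/
def rect (m n : ℕ) : YoungDiagram where
  cells := Finset.range m ×ˢ Finset.range n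
  isLowerSet := by
    rintro ⟨a1, a2⟩ ⟨b1, b2⟩ ⟨h1, h2⟩ ha
    simp only [Finset.coe_product, Finset.coe_range, Set.mem_prod, Set.mem_Iio] at ha ⊢
    exact ⟨lt_of_le_of_lt h1 ha.1, lt_of_le_of_lt h2 ha.2⟩

end YoungDiagram

/-- The Multiple Hook Removing Game with starting position `Y` and numbering `α` (of which only the
values on `Y` matter). Its positions are the Young diagrams that can be reached from `Y`. -/
def MHRG (Y : YoungDiagram) (α : ℕ × ℕ → ℕ) : ImpartialGame where
  Pos := {Z : YoungDiagram // Relation.ReflTransGen (YoungDiagram.MHRGMove α) Y Z}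
  Move p q := YoungDiagram.MHRGMove α p.1 q.1
  start := ⟨Y, Relation.ReflTransGen.refl⟩
  finite_reachable := by
    intro p
    refine Set.Finite.of_finite_image (f := Subtype.val) ?_ Subtype.val_injective.injOn
    refine (YoungDiagram.finite_Iic p.1).subset ?_
    rintro _ ⟨q, hq, rfl⟩
    change Relation.ReflTransGen _ p q at hq
    induction hq with
    | refl => exact le_refl p.1
    | tail _ h ih => exact h.lt.le.trans ih
  acyclic := by
    intro p hp
    have key : ∀ q, Relation.TransGen (fun p q : {Z : YoungDiagram //
        Relation.ReflTransGen (YoungDiagram.MHRGMove α) Y Z} =>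
        YoungDiagram.MHRGMove α p.1 q.1) p q → q.1 < p.1 := by
      intro q hq
      induction hq with
      | single h => exact h.lt
      | tail _ h ih => exact h.lt.trans ih
    exact lt_irrefl _ (key p hp)

/-- The unimodal numbering `min (j - i + m) (i - j + n)` of the boxes `(i, j)` of the `m × n`
rectangle. The value depends on `j - i` only, so it is unaffected by indexing boxes from `(0, 0)`;
for `i < m` and `j < n` the subtractions do not truncate and the value is positive. -/
def unimodalNumbering (m n : ℕ) (c : ℕ × ℕ) : ℕ :=
  min (c.2 + m - c.1) (c.1 + n - c.2)

/-- `MHRG(m,n)`: the game whose starting position is the `m × n` rectangle with the unimodal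
numbering. -/
def rectMHRG (m n : ℕ) : ImpartialGame :=
  MHRG (YoungDiagram.rect m n) (unimodalNumbering m n)

/-- The nim-sum `1 ⊕ 2 ⊕ ⋯ ⊕ n` (binary addition without carry). -/
def nimSumUpTo (n : ℕ) : ℕ :=
  (Finset.Icc 1 n).fold (fun a b => a ^^^ b) 0 fun k => k

/-! Follow the boundary of a diagram from bottom left to top right, indexing its steps by integers;
the set `edges` of vertical steps records the diagram. A box is a horizontal step `q` preceding a
vertical step `p`; removing its hook exchanges the two (`edges_removeHook`), and the hook has one
box of each content in `[q, p - 1]`. Since the numbering is unimodal and symmetric, the numbers of a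
hook determine `(q, p)` up to reflection about the middle (`map_contentNumber_eq_iff`).

For the `n × (n + δ)` rectangle with `δ ≤ 1`, the path is antisymmetric under `k ↦ 1 + δ - k`. A
turn exchanges `q` and `p` and also their mirror images, so antisymmetry persists and the right half
of the path determines the position. It is a row of `n` coins, coin `x` showing heads when step `x +
δ` is vertical, and a turn is a move of Turning Turtles: some `x` goes from heads to tails, and at
most one smaller `y` is turned over as well.

The nim-sum of the heads, `balancedValue`, changes in every move
(`IsBalanced.balancedValue_swapEdges`) and can be lowered to any smaller value
(`exists_turn_of_lt_nimSum`, `IsBalanced.exists_move_turn`), so it is the `𝒢`-value. In the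
rectangle all coins show heads. -/

namespace YoungDiagram

/-! ### Hooks and the boundary path of a Young diagram -/

/-- The positions, along the boundary path of `Y`, of the vertical steps: the right end of row `i`
separates the diagonals of content `rowLen i - i - 1` and `rowLen i - i`. -/
def edges (Y : YoungDiagram) : Set ℤ := Set.range fun i : ℕ => (Y.rowLen i : ℤ) - i

theorem lt_rowLen_iff_lt_colLen (Y : YoungDiagram) (i j : ℕ) :
    j < Y.rowLen i ↔ i < Y.colLen j := by
  rw [← mem_iff_lt_rowLen, mem_iff_lt_colLen]

theorem mem_removeHook (Y : YoungDiagram) (i j a b : ℕ) :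
    (a, b) ∈ Y.removeHook (i, j) ↔
      ((a, b) ∈ Y ∧ (a < i ∨ b < j)) ∨ (i ≤ a ∧ j ≤ b ∧ (a + 1, b + 1) ∈ Y) := by
  rw [← mem_cells]
  simp only [removeHook, Finset.mem_image, Finset.mem_sdiff, hook, Finset.mem_filter, hookShift,
    mem_cells, Prod.exists, Prod.mk.injEq]
  constructor
  · rintro ⟨b1, b2, ⟨hb, hn⟩, he⟩
    split_ifs at he with h
    · simp only [Prod.mk.injEq] at he
      obtain rfl : a + 1 = b1 := by omega
      obtain rfl : b + 1 = b2 := by omega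
      exact Or.inr ⟨by omega, by omega, hb⟩
    · simp only [Prod.mk.injEq] at he
      obtain ⟨rfl, rfl⟩ := he
      refine Or.inl ⟨hb, ?_⟩
      by_contra hc
      exact hn ⟨hb, by omega⟩
  · rintro (⟨ha, h⟩ | ⟨h1, h2, ha⟩)
    · refine ⟨a, b, ⟨ha, ?_⟩, by rw [if_neg (by omega)]⟩
      rintro ⟨-, h'⟩
      omega
    · refine ⟨a + 1, b + 1, ⟨ha, ?_⟩, by rw [if_pos (by omega)]; rfl⟩
      rintro ⟨-, h'⟩
      omega

theorem lt_rowLen_removeHook (Y : YoungDiagram) (i j a b : ℕ) :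
    b < (Y.removeHook (i, j)).rowLen a ↔
      (b < Y.rowLen a ∧ (a < i ∨ b < j)) ∨ (i ≤ a ∧ j ≤ b ∧ b + 1 < Y.rowLen (a + 1)) := by
  simp only [← mem_iff_lt_rowLen, mem_removeHook]

theorem rowLen_removeHook_of_lt (Y : YoungDiagram) {i a : ℕ} (j : ℕ) (h : a < i) :
    (Y.removeHook (i, j)).rowLen a = Y.rowLen a := by
  refine eq_of_forall_lt_iff fun b => ?_
  rw [lt_rowLen_removeHook]
  omega

/-- The row moves up by one and loses one box, so its end stays on the same diagonal and `edges`
does not notice the change. -/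
theorem rowLen_removeHook_of_lt_colLen (Y : YoungDiagram) {i j a : ℕ} (h : i ≤ a)
    (ha : a + 1 < Y.colLen j) : (Y.removeHook (i, j)).rowLen a = Y.rowLen (a + 1) - 1 := by
  refine eq_of_forall_lt_iff fun b => ?_
  rw [lt_rowLen_removeHook]
  have h1 := (Y.lt_rowLen_iff_lt_colLen (a + 1) j).2 ha
  have h2 := Y.rowLen_anti a (a + 1) (by omega)
  omega

theorem rowLen_removeHook_of_eq_colLen (Y : YoungDiagram) {i j a : ℕ} (h : i ≤ a)
    (ha : a + 1 = Y.colLen j) : (Y.removeHook (i, j)).rowLen a = j := by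
  refine eq_of_forall_lt_iff fun b => ?_
  rw [lt_rowLen_removeHook]
  have h1 := Y.lt_rowLen_iff_lt_colLen (a + 1) j
  have h2 := Y.lt_rowLen_iff_lt_colLen a j
  omega

theorem rowLen_removeHook_of_colLen_le (Y : YoungDiagram) {i j a : ℕ}
    (ha : Y.colLen j ≤ a) : (Y.removeHook (i, j)).rowLen a = Y.rowLen a := by
  refine eq_of_forall_lt_iff fun b => ?_
  rw [lt_rowLen_removeHook]
  have h1 := Y.lt_rowLen_iff_lt_colLen (a + 1) j
  have h2 := Y.lt_rowLen_iff_lt_colLen a j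
  omega

theorem rowLen_sub_strictAnti (Y : YoungDiagram) {a b : ℕ} (h : a < b) :
    (Y.rowLen b : ℤ) - b < (Y.rowLen a : ℤ) - a := by
  have := Y.rowLen_anti a b h.le
  omega

/-- The horizontal step at the bottom of a column is not a vertical step. -/
theorem colEnd_notMem_edges (Y : YoungDiagram) (j : ℕ) :
    (j : ℤ) - Y.colLen j + 1 ∉ Y.edges := by
  rintro ⟨i, hi⟩
  have := Y.lt_rowLen_iff_lt_colLen i j
  dsimp only at hi
  omega

/-- Every step of the boundary path that is not vertical is the bottom of a column. -/
theorem exists_colEnd_eq (Y : YoungDiagram) {k : ℤ} (hk : k ∉ Y.edges) :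
    ∃ j : ℕ, (j : ℤ) - Y.colLen j + 1 = k := by
  classical
  have hex : ∃ i : ℕ, (Y.rowLen i : ℤ) - i < k := by
    refine ⟨Y.rowLen 0 + k.natAbs + 1, ?_⟩
    have := Y.rowLen_anti 0 (Y.rowLen 0 + k.natAbs + 1) (by omega)
    have := neg_le_abs k
    push_cast
    omega
  set i := Nat.find hex with hi
  have h1 : (Y.rowLen i : ℤ) - i < k := Nat.find_spec hex
  -- Step `k` lies between the ends of rows `i - 1` and `i`, so its column has length `i`; solving
  -- `j - i + 1 = k` gives `j`.
  refine ⟨(k + i - 1).toNat, ?_⟩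
  have h2 := Y.lt_rowLen_iff_lt_colLen i (k + i - 1).toNat
  rcases Nat.eq_zero_or_pos i with h0 | h0
  · omega
  · have h3 : ¬ ((Y.rowLen (i - 1) : ℤ) - (i - 1 : ℕ) < k) := Nat.find_min hex (by omega)
    have h4 : (Y.rowLen (i - 1) : ℤ) - (i - 1 : ℕ) ≠ k := fun h => hk ⟨i - 1, h⟩
    have h5 := Y.lt_rowLen_iff_lt_colLen (i - 1) (k + i - 1).toNat
    omega

/-- Boxes are the inversions of the boundary path. -/
theorem colEnd_lt_rowEnd_iff (Y : YoungDiagram) (i j : ℕ) :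
    (j : ℤ) - Y.colLen j + 1 < (Y.rowLen i : ℤ) - i ↔ (i, j) ∈ Y := by
  rw [mem_iff_lt_rowLen]
  have := Y.lt_rowLen_iff_lt_colLen i j
  omega

/-- Removing a hook exchanges the vertical step and the horizontal step at its two ends. -/
theorem edges_removeHook (Y : YoungDiagram) {i j : ℕ} (hc : (i, j) ∈ Y) :
    (Y.removeHook (i, j)).edges =
      insert ((j : ℤ) - Y.colLen j + 1) (Y.edges \ {(Y.rowLen i : ℤ) - i}) := by
  have hi : i < Y.colLen j := mem_iff_lt_colLen.1 hc
  ext k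
  simp only [edges, Set.mem_insert_iff, Set.mem_sdiff, Set.mem_singleton_iff, Set.mem_range]
  constructor
  · rintro ⟨a, rfl⟩
    rcases lt_or_ge a i with h | h
    · rw [rowLen_removeHook_of_lt Y j h]
      exact Or.inr ⟨⟨a, rfl⟩, (Y.rowLen_sub_strictAnti h).ne'⟩
    rcases lt_trichotomy (a + 1) (Y.colLen j) with h' | h' | h'
    · rw [rowLen_removeHook_of_lt_colLen Y h h']
      have h1 := (Y.lt_rowLen_iff_lt_colLen (a + 1) j).2 h'
      have h2 := Y.rowLen_sub_strictAnti (show i < a + 1 by omega)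
      exact Or.inr ⟨⟨a + 1, by omega⟩, by omega⟩
    · rw [rowLen_removeHook_of_eq_colLen Y h h']
      exact Or.inl (by omega)
    · rw [rowLen_removeHook_of_colLen_le Y (by omega)]
      exact Or.inr ⟨⟨a, rfl⟩, (Y.rowLen_sub_strictAnti (show i < a by omega)).ne⟩
  · rintro (rfl | ⟨⟨a, rfl⟩, hne⟩)
    · refine ⟨Y.colLen j - 1, ?_⟩
      rw [rowLen_removeHook_of_eq_colLen Y (by omega) (by omega)]
      omega
    · rcases lt_trichotomy a i with h | rfl | h
      · exact ⟨a, by rw [rowLen_removeHook_of_lt Y j h]⟩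
      · exact absurd rfl hne
      rcases lt_or_ge a (Y.colLen j) with h' | h'
      · refine ⟨a - 1, ?_⟩
        have h1 := (Y.lt_rowLen_iff_lt_colLen a j).2 h'
        rw [rowLen_removeHook_of_lt_colLen Y (by omega) (by omega), Nat.sub_add_cancel (by omega)]
        omega
      · exact ⟨a, by rw [rowLen_removeHook_of_colLen_le Y h']⟩

/-- The contents of the boxes of a hook are distinct and form an interval. -/
theorem hookNumbers_eq_map_Icc (Y : YoungDiagram) {α : ℕ × ℕ → ℕ} {f : ℤ → ℕ}
    (hf : ∀ b : ℕ × ℕ, α b = f ((b.2 : ℤ) - b.1)) {i j : ℕ} (hc : (i, j) ∈ Y) :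
    hookNumbers α Y (i, j) =
      (Finset.Icc ((j : ℤ) - Y.colLen j + 1) ((Y.rowLen i : ℤ) - i - 1)).val.map f := by
  have hr : j < Y.rowLen i := mem_iff_lt_rowLen.1 hc
  have hl : i < Y.colLen j := mem_iff_lt_colLen.1 hc
  have hmem : ∀ a b : ℕ, (a, b) ∈ Y.hook (i, j) ↔
      (i ≤ a ∧ a < Y.colLen j ∧ b = j) ∨ (a = i ∧ j < b ∧ b < Y.rowLen i) := by
    intro a b
    simp only [hook, Finset.mem_filter, mem_cells, Prod.mk.injEq]
    constructor
    · rintro ⟨hab, ⟨rfl, rfl⟩ | ⟨h, rfl⟩ | ⟨rfl, h⟩⟩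
      · exact Or.inl ⟨le_rfl, hl, rfl⟩
      · exact Or.inl ⟨h.le, mem_iff_lt_colLen.1 hab, rfl⟩
      · exact Or.inr ⟨rfl, h, mem_iff_lt_rowLen.1 hab⟩
    · rintro (⟨h1, h2, rfl⟩ | ⟨rfl, h1, h2⟩)
      · exact ⟨mem_iff_lt_colLen.2 h2, by omega⟩
      · exact ⟨mem_iff_lt_rowLen.2 h2, by omega⟩
  have himg : (Y.hook (i, j)).image (fun b : ℕ × ℕ => (b.2 : ℤ) - b.1) =
      Finset.Icc ((j : ℤ) - Y.colLen j + 1) ((Y.rowLen i : ℤ) - i - 1) := by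
    ext k
    simp only [Finset.mem_image, Prod.exists, hmem, Finset.mem_Icc]
    constructor
    · rintro ⟨a, b, h, rfl⟩
      omega
    · rintro ⟨h1, h2⟩
      -- Contents up to that of the corner come from the leg, larger ones from the arm.
      rcases le_or_gt k ((j : ℤ) - i) with h | h
      · exact ⟨(j - k).toNat, j, by omega⟩
      · exact ⟨i, (k + i).toNat, by omega⟩
  have hinj : Set.InjOn (fun b : ℕ × ℕ => (b.2 : ℤ) - b.1) (Y.hook (i, j)) := by
    rintro ⟨a, b⟩ h ⟨a', b'⟩ h' he
    rw [Finset.mem_coe, hmem] at h h'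
    dsimp only at he
    simp only [Prod.mk.injEq]
    omega
  rw [← himg, Finset.image_val_of_injOn hinj, Multiset.map_map]
  exact Multiset.map_congr rfl fun b _ => hf b

/-- The ends of the hook of a box, its multiset of numbers, and the effect of its removal. -/
theorem exists_ends_of_mem (Y : YoungDiagram) {α : ℕ × ℕ → ℕ} {f : ℤ → ℕ}
    (hf : ∀ b : ℕ × ℕ, α b = f ((b.2 : ℤ) - b.1)) {c : ℕ × ℕ} (hc : c ∈ Y) :
    ∃ q p : ℤ, q ∉ Y.edges ∧ p ∈ Y.edges ∧ q < p ∧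
      hookNumbers α Y c = (Finset.Icc q (p - 1)).val.map f ∧
      (Y.removeHook c).edges = insert q (Y.edges \ {p}) :=
  ⟨_, _, Y.colEnd_notMem_edges c.2, ⟨c.1, rfl⟩, (Y.colEnd_lt_rowEnd_iff c.1 c.2).2 hc,
    Y.hookNumbers_eq_map_Icc hf hc, Y.edges_removeHook hc⟩

/-- A horizontal step preceding a vertical one are the ends of a hook. -/
theorem exists_mem_of_ends (Y : YoungDiagram) {α : ℕ × ℕ → ℕ} {f : ℤ → ℕ}
    (hf : ∀ b : ℕ × ℕ, α b = f ((b.2 : ℤ) - b.1)) {q p : ℤ} (hq : q ∉ Y.edges)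
    (hp : p ∈ Y.edges) (hqp : q < p) :
    ∃ c ∈ Y, hookNumbers α Y c = (Finset.Icc q (p - 1)).val.map f ∧
      (Y.removeHook c).edges = insert q (Y.edges \ {p}) := by
  obtain ⟨j, rfl⟩ := Y.exists_colEnd_eq hq
  obtain ⟨i, rfl⟩ := hp
  have hc := (Y.colEnd_lt_rowEnd_iff i j).1 hqp
  exact ⟨(i, j), hc, Y.hookNumbers_eq_map_Icc hf hc, Y.edges_removeHook hc⟩

end YoungDiagram

/-! ### The unimodal numbering -/

/-- The unimodal numbering as a function of the content `j - i`. -/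
def contentNumber (m n : ℕ) (k : ℤ) : ℕ := min (k + m).toNat (n - k).toNat

theorem unimodalNumbering_eq_contentNumber (m n : ℕ) (b : ℕ × ℕ) :
    unimodalNumbering m n b = contentNumber m n ((b.2 : ℤ) - b.1) := by
  unfold unimodalNumbering contentNumber
  omega

/-- The multiset of numbers on an interval of contents determines the interval up to reflection. -/
theorem map_contentNumber_eq_iff {m n : ℕ} {q p q' p' : ℤ} (hq : 1 - (m : ℤ) ≤ q) (hqp : q < p)
    (hp : p ≤ n) (hq' : 1 - (m : ℤ) ≤ q') (hqp' : q' < p') (hp' : p' ≤ n) :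
    (Finset.Icc q' (p' - 1)).val.map (contentNumber m n) =
        (Finset.Icc q (p - 1)).val.map (contentNumber m n) ↔
      (q' = q ∧ p' = p) ∨ (q' = n - m + 1 - p ∧ p' = n - m + 1 - q) := by
  constructor
  · intro h
    have hcard := congrArg Multiset.card h
    simp only [Multiset.card_map, Finset.card_val, Int.card_Icc] at hcard
    have mem : ∀ {a b a' b' : ℤ}, (Finset.Icc a b).val.map (contentNumber m n) =
        (Finset.Icc a' b').val.map (contentNumber m n) → ∀ k, a ≤ k → k ≤ b →
        ∃ l, a' ≤ l ∧ l ≤ b' ∧ contentNumber m n l = contentNumber m n k := by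
      intro a b a' b' h k h1 h2
      have hk : contentNumber m n k ∈ (Finset.Icc a b).val.map (contentNumber m n) :=
        Multiset.mem_map_of_mem _ (Finset.mem_Icc.2 ⟨h1, h2⟩)
      rw [h] at hk
      obtain ⟨l, hl, he⟩ := Multiset.mem_map.1 hk
      exact ⟨l, (Finset.mem_Icc.1 hl).1, (Finset.mem_Icc.1 hl).2, he⟩
    obtain ⟨k1, _, _, e1⟩ := mem h q' le_rfl (by omega)
    obtain ⟨k2, _, _, e2⟩ := mem h (p' - 1) (by omega) le_rfl
    obtain ⟨k3, _, _, e3⟩ := mem h.symm q le_rfl (by omega)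
    obtain ⟨k4, _, _, e4⟩ := mem h.symm (p - 1) (by omega) le_rfl
    have hval : ∀ k : ℤ, 1 - (m : ℤ) ≤ k → k ≤ n →
        (contentNumber m n k : ℤ) = min (k + m) (n - k) := by
      intro k h1 h2
      unfold contentNumber
      omega
    have hv1 := hval k1 (by omega) (by omega)
    have hv2 := hval k2 (by omega) (by omega)
    have hv3 := hval k3 (by omega) (by omega)
    have hv4 := hval k4 (by omega) (by omega)
    have hw1 := hval q' (by omega) (by omega)
    have hw2 := hval (p' - 1) (by omega) (by omega)
    have hw3 := hval q (by omega) (by omega)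
    have hw4 := hval (p - 1) (by omega) (by omega)
    rw [e1] at hv1
    rw [e2] at hv2
    rw [e3] at hv3
    rw [e4] at hv4
    -- By unimodality the least number of an interval sits at the end farther from the centre. Equal
    -- least numbers and equal lengths leave only the interval and its mirror image.
    rcases le_total (q + p - 1) (n - m : ℤ) with h5 | h5 <;>
      rcases le_total (q' + p' - 1) (n - m : ℤ) with h6 | h6
    · rw [min_eq_left (by omega)] at hw1 hw3
      exact Or.inl (by omega)
    · rw [min_eq_right (by omega)] at hw2
      rw [min_eq_left (by omega)] at hw3
      exact Or.inr (by omega)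
    · rw [min_eq_left (by omega)] at hw1
      rw [min_eq_right (by omega)] at hw4
      exact Or.inr (by omega)
    · rw [min_eq_right (by omega)] at hw2 hw4
      exact Or.inl (by omega)
  · rintro (⟨rfl, rfl⟩ | ⟨rfl, rfl⟩)
    · rfl
    · have himg : Finset.Icc ((n : ℤ) - m + 1 - p) (n - m + 1 - q - 1) =
          (Finset.Icc q (p - 1)).image fun k => (n : ℤ) - m - k := by
        ext k
        simp only [Finset.mem_Icc, Finset.mem_image]
        constructor
        · intro h
          exact ⟨n - m - k, by omega⟩
        · rintro ⟨l, h, rfl⟩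
          omega
      rw [himg, Finset.image_val_of_injOn (fun a _ b _ h => by omega),
        Multiset.map_map]
      refine Multiset.map_congr rfl fun k _ => ?_
      simp only [Function.comp_apply, contentNumber]
      omega

/-! ### Symmetric positions -/

namespace YoungDiagram

/-- The diagrams inside the `n × (n + δ)` rectangle whose boundary path is antisymmetric about the
middle of the rectangle, with a horizontal step in the middle when there is one. -/
structure IsBalanced (n δ : ℕ) (Y : YoungDiagram) : Prop where
  le_of_mem : ∀ k ∈ Y.edges, k ≤ n + δ
  reflect_notMem : ∀ k ∈ Y.edges, 1 + (δ : ℤ) - k ∉ Y.edges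
  reflect_mem : ∀ k ∉ Y.edges, 2 * k ≠ 1 + δ → 1 + (δ : ℤ) - k ∈ Y.edges

/-- A horizontal step further left would have a vertical mirror image beyond `n + δ`. -/
theorem IsBalanced.le_of_notMem {n δ : ℕ} {Y : YoungDiagram} (hY : Y.IsBalanced n δ) {k : ℤ}
    (hk : k ∉ Y.edges) : 1 - (n : ℤ) ≤ k := by
  by_contra h
  have := hY.le_of_mem _ (hY.reflect_mem k hk (by omega))
  omega

/-- The boundary path after exchanging the steps `q` and `p` and then their mirror images. -/
def swapEdges (δ : ℕ) (V : Set ℤ) (q p : ℤ) : Set ℤ :=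
  -- The order matters: a middle step `q` is its own mirror image, so it is inserted and then
  -- removed again.
  insert (1 + (δ : ℤ) - p) (insert q (V \ {p}) \ {1 + (δ : ℤ) - q})

theorem mem_swapEdges {δ : ℕ} {V : Set ℤ} {q p k : ℤ} :
    k ∈ swapEdges δ V q p ↔
      k = 1 + (δ : ℤ) - p ∨ ((k = q ∨ (k ∈ V ∧ k ≠ p)) ∧ k ≠ 1 + (δ : ℤ) - q) := by
  simp [swapEdges]

/-- The numbers of the hook with ends `q` and `p`. -/
noncomputable def endsNumbers (n δ : ℕ) (q p : ℤ) : Multiset ℕ :=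
  (Finset.Icc q (p - 1)).val.map (contentNumber n (n + δ))

theorem endsNumbers_eq_iff {n δ : ℕ} {q p q' p' : ℤ} (hq : 1 - (n : ℤ) ≤ q) (hqp : q < p)
    (hp : p ≤ n + δ) (hq' : 1 - (n : ℤ) ≤ q') (hqp' : q' < p') (hp' : p' ≤ n + δ) :
    endsNumbers n δ q' p' = endsNumbers n δ q p ↔
      (q' = q ∧ p' = p) ∨ (q' = 1 + (δ : ℤ) - p ∧ p' = 1 + (δ : ℤ) - q) := by
  unfold endsNumbers
  rw [map_contentNumber_eq_iff hq hqp (by push_cast; exact hp) hq' hqp' (by push_cast; exact hp')]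
  push_cast
  omega

/-- A hook with the numbers of the ends `q`, `p` must have these ends or their mirror images. -/
theorem ends_of_hookNumbers_eq {n δ : ℕ} {X : YoungDiagram} {q p : ℤ}
    (hup : ∀ k ∈ X.edges, k ≤ n + δ) (hlow : ∀ k ∉ X.edges, 1 - (n : ℤ) ≤ k)
    (hq : 1 - (n : ℤ) ≤ q) (hqp : q < p) (hp : p ≤ n + δ) {c : ℕ × ℕ} (hc : c ∈ X)
    (hA : hookNumbers (unimodalNumbering n (n + δ)) X c = endsNumbers n δ q p) :
    (q ∉ X.edges ∧ p ∈ X.edges ∧ (X.removeHook c).edges = insert q (X.edges \ {p})) ∨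
      (1 + (δ : ℤ) - p ∉ X.edges ∧ 1 + (δ : ℤ) - q ∈ X.edges ∧
        (X.removeHook c).edges =
          insert (1 + (δ : ℤ) - p) (X.edges \ {1 + (δ : ℤ) - q})) := by
  obtain ⟨q', p', h1, h2, h3, h4, h5⟩ :=
    X.exists_ends_of_mem (unimodalNumbering_eq_contentNumber n (n + δ)) hc
  have h6 : endsNumbers n δ q' p' = endsNumbers n δ q p := h4.symm.trans hA
  rcases (endsNumbers_eq_iff hq hqp hp (hlow _ h1) h3 (hup _ h2)).1 h6 with
    ⟨rfl, rfl⟩ | ⟨rfl, rfl⟩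
  · exact Or.inl ⟨h1, h2, h5⟩
  · exact Or.inr ⟨h1, h2, h5⟩

/-! ### One turn from a balanced position -/

section Turn

variable {n δ : ℕ} {Y X : YoungDiagram} {q p : ℤ}

/-- A hook that is its own mirror image needs only one exchange. -/
theorem swapEdges_of_add_eq (hqp : q < p) (hs : q + p = 1 + δ) :
    swapEdges δ Y.edges q p = insert q (Y.edges \ {p}) := by
  ext k
  rw [mem_swapEdges]
  simp only [Set.mem_insert_iff, Set.mem_sdiff, Set.mem_singleton_iff]
  by_cases hk : k = q
  · subst hk
    exact ⟨fun _ => Or.inl rfl, fun _ => Or.inl (by omega)⟩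
  · constructor
    · rintro (h | ⟨h | h, -⟩)
      · omega
      · exact Or.inl h
      · exact Or.inr h
    · rintro (h | h)
      · exact absurd h hk
      · exact Or.inr ⟨Or.inr h, by omega⟩

/-- The bounds on the steps survive the removal of the first hook. -/
theorem IsBalanced.bounds_insert (hY : Y.IsBalanced n δ) (hq : q ∉ Y.edges) (hp : p ∈ Y.edges)
    (hqp : q < p) (hX : X.edges = insert q (Y.edges \ {p})) :
    (∀ k ∈ X.edges, k ≤ n + δ) ∧ ∀ k ∉ X.edges, 1 - (n : ℤ) ≤ k := by
  have h1 := hY.le_of_mem p hp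
  have h2 := hY.le_of_notMem hq
  rw [hX]
  constructor
  · rintro k (rfl | ⟨hk, -⟩)
    · omega
    · exact hY.le_of_mem k hk
  · intro k hk
    simp only [Set.mem_insert_iff, Set.mem_sdiff, Set.mem_singleton_iff] at hk
    by_cases hkp : k = p
    · omega
    · exact hY.le_of_notMem fun h => hk (Or.inr ⟨h, hkp⟩)

theorem IsBalanced.swapEdges_balanced (hY : Y.IsBalanced n δ) (hq : q ∉ Y.edges)
    (hp : p ∈ Y.edges) (hqp : q < p) (hX : X.edges = swapEdges δ Y.edges q p) :
    X.IsBalanced n δ := by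
  have h1 := hY.le_of_mem p hp
  have h2 := hY.le_of_notMem hq
  have h3 := hY.reflect_notMem p hp
  have hpm : p ≠ 1 + δ - p := fun h => h3 (h ▸ hp)
  refine ⟨fun k hk => ?_, fun k hk => ?_, fun k hk hk2 => ?_⟩
  · rw [hX, mem_swapEdges] at hk
    rcases hk with h | ⟨h | h, -⟩
    · omega
    · omega
    · exact hY.le_of_mem k h.1
  · rw [hX, mem_swapEdges] at hk ⊢
    rintro (h | ⟨h | h, h'⟩)
    · rcases hk with hk | ⟨hk | hk, hk'⟩
      · omega
      · omega
      · exact hk.2 (by omega)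
    · rcases hk with hk | ⟨hk | hk, hk'⟩
      · omega
      · omega
      · omega
    · rcases hk with hk | ⟨hk | hk, hk'⟩
      · omega
      · omega
      · exact hY.reflect_notMem k hk.1 h.1
  · rw [hX, mem_swapEdges] at hk ⊢
    push Not at hk
    by_cases e1 : k = p
    · exact Or.inl (by omega)
    by_cases e2 : k = 1 + δ - q
    · exact Or.inr ⟨Or.inl (by omega), by omega⟩
    have hkV : k ∉ Y.edges := fun h => e2 (hk.2 (Or.inr ⟨h, e1⟩))
    have hkq : k ≠ q := fun h => e2 (hk.2 (Or.inl h))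
    exact Or.inr ⟨Or.inr ⟨hY.reflect_mem k hkV hk2, by omega⟩, by omega⟩

/-- Once the two mirror exchanges are done, no hook with the same numbers is left. -/
theorem IsBalanced.hookNumbers_ne (hY : Y.IsBalanced n δ) (hq : q ∉ Y.edges) (hp : p ∈ Y.edges)
    (hqp : q < p) (hX : X.edges = swapEdges δ Y.edges q p) (c : ℕ × ℕ) (hc : c ∈ X) :
    hookNumbers (unimodalNumbering n (n + δ)) X c ≠ endsNumbers n δ q p := by
  intro hA
  have hXb := hY.swapEdges_balanced hq hp hqp hX
  have hpm : p ≠ 1 + δ - p := fun h => hY.reflect_notMem p hp (h ▸ hp)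
  -- Now `p` is horizontal and its mirror image is vertical, which rules out both candidate hooks.
  rcases ends_of_hookNumbers_eq hXb.le_of_mem (fun k hk => hXb.le_of_notMem hk)
    (hY.le_of_notMem hq) hqp (hY.le_of_mem p hp) hc hA with ⟨-, h, -⟩ | ⟨h, -, -⟩
  · rw [hX, mem_swapEdges] at h
    omega
  · rw [hX, mem_swapEdges] at h
    exact h (Or.inl rfl)

/-- After the first of two distinct mirror exchanges, the second one is available. -/
theorem IsBalanced.mirror_available (hY : Y.IsBalanced n δ) (hq : q ∉ Y.edges)
    (hp : p ∈ Y.edges) (hs : q + p ≠ 1 + δ)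
    (hX : X.edges = insert q (Y.edges \ {p})) :
    1 + (δ : ℤ) - p ∉ X.edges ∧ 1 + (δ : ℤ) - q ∈ X.edges := by
  have h3 := hY.reflect_notMem p hp
  rw [hX]
  constructor
  · rintro (h | h)
    · omega
    · exact h3 h.1
  -- A middle step `q` has just become vertical and serves as the right end of the second hook.
  · by_cases hm : 2 * q = 1 + δ
    · exact Or.inl (by omega)
    · exact Or.inr ⟨hY.reflect_mem q hq hm, fun h => hs (by rw [Set.mem_singleton_iff] at h; omega)⟩

/-- The rest of the turn leaves no choice: it is empty for a self-mirror hook, and otherwise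
consists of the mirror exchange alone. -/
theorem IsBalanced.edges_of_forced (hY : Y.IsBalanced n δ) (hq : q ∉ Y.edges) (hp : p ∈ Y.edges)
    (hqp : q < p) (hX : X.edges = insert q (Y.edges \ {p})) {Z : YoungDiagram}
    (h : Forced (unimodalNumbering n (n + δ)) (endsNumbers n δ q p) X Z) :
    Z.edges = swapEdges δ Y.edges q p := by
  by_cases hs : q + p = 1 + δ
  · rw [← swapEdges_of_add_eq hqp hs] at hX
    rcases h with ⟨_, -⟩ | ⟨_, _, c, hc, hA, -⟩
    · exact hX
    · exact absurd hA (hY.hookNumbers_ne hq hp hqp hX c hc)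
  · obtain ⟨h1, h2⟩ := hY.mirror_available hq hp hs hX
    obtain ⟨hup, hlow⟩ := hY.bounds_insert hq hp hqp hX
    rcases h with ⟨_, h⟩ | ⟨_, _, c, hc, hA, h⟩
    -- The turn cannot end here, because the mirror hook is still present.
    · obtain ⟨c, hc, hA, -⟩ := X.exists_mem_of_ends
        (unimodalNumbering_eq_contentNumber n (n + δ)) h1 h2 (by omega)
      refine absurd (hA.trans ?_) (h c hc)
      exact (endsNumbers_eq_iff (hY.le_of_notMem hq) hqp (hY.le_of_mem p hp) (hlow _ h1)
        (by omega) (hup _ h2)).2 (Or.inr ⟨rfl, rfl⟩)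
    · rcases ends_of_hookNumbers_eq hup hlow (hY.le_of_notMem hq) hqp (hY.le_of_mem p hp) hc hA
        with ⟨h3, -, -⟩ | ⟨-, -, h3⟩
      · exact absurd (by rw [hX]; exact Or.inl rfl) h3
      · rw [hX] at h3
        rcases h with ⟨_, -⟩ | ⟨_, _, c', hc', hA', -⟩
        · exact h3
        · exact absurd hA' (hY.hookNumbers_ne hq hp hqp h3 c' hc')

theorem IsBalanced.exists_forced (hY : Y.IsBalanced n δ) (hq : q ∉ Y.edges) (hp : p ∈ Y.edges)
    (hqp : q < p) (hX : X.edges = insert q (Y.edges \ {p})) :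
    ∃ Z, Forced (unimodalNumbering n (n + δ)) (endsNumbers n δ q p) X Z := by
  by_cases hs : q + p = 1 + δ
  · rw [← swapEdges_of_add_eq hqp hs] at hX
    exact ⟨X, Forced.done X (hY.hookNumbers_ne hq hp hqp hX)⟩
  · obtain ⟨h1, h2⟩ := hY.mirror_available hq hp hs hX
    obtain ⟨hup, hlow⟩ := hY.bounds_insert hq hp hqp hX
    obtain ⟨c, hc, hA, h3⟩ := X.exists_mem_of_ends
      (unimodalNumbering_eq_contentNumber n (n + δ)) h1 h2 (by omega)
    rw [hX] at h3
    refine ⟨X.removeHook c, Forced.step X _ c hc (hA.trans ?_)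
      (Forced.done _ (hY.hookNumbers_ne hq hp hqp h3))⟩
    exact (endsNumbers_eq_iff (hY.le_of_notMem hq) hqp (hY.le_of_mem p hp) (hlow _ h1)
      (by omega) (hup _ h2)).2 (Or.inr ⟨rfl, rfl⟩)

/-- A move from a balanced position exchanges two steps and their mirror images. -/
theorem IsBalanced.edges_of_move (hY : Y.IsBalanced n δ) {Z : YoungDiagram}
    (h : MHRGMove (unimodalNumbering n (n + δ)) Y Z) :
    ∃ q p : ℤ, q ∉ Y.edges ∧ p ∈ Y.edges ∧ q < p ∧ Z.edges = swapEdges δ Y.edges q p := by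
  obtain ⟨c, hc, hf⟩ := h
  obtain ⟨q, p, hq, hp, hqp, hA, hX⟩ :=
    Y.exists_ends_of_mem (unimodalNumbering_eq_contentNumber n (n + δ)) hc
  rw [hA] at hf
  exact ⟨q, p, hq, hp, hqp, hY.edges_of_forced hq hp hqp hX hf⟩

theorem IsBalanced.exists_move (hY : Y.IsBalanced n δ) (hq : q ∉ Y.edges) (hp : p ∈ Y.edges)
    (hqp : q < p) :
    ∃ Z, MHRGMove (unimodalNumbering n (n + δ)) Y Z ∧ Z.edges = swapEdges δ Y.edges q p := by
  obtain ⟨c, hc, hA, hX⟩ :=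
    Y.exists_mem_of_ends (unimodalNumbering_eq_contentNumber n (n + δ)) hq hp hqp
  obtain ⟨Z, hZ⟩ := hY.exists_forced hq hp hqp hX
  exact ⟨Z, ⟨c, hc, by rw [hA]; exact hZ⟩, hY.edges_of_forced hq hp hqp hX hZ⟩

end Turn

end YoungDiagram

/-! ### Nim-sums -/

/-- The nim-sum of the elements of `s` satisfying `P`. -/
noncomputable def nimSum (s : Finset ℕ) (P : ℕ → Prop) : ℕ :=
  open Classical in s.fold (fun a b : ℕ => a ^^^ b) 0 fun k => if P k then k else 0

/-- This writes `x` as a nim-sum over `s`, so that a toggle can be checked summand by summand; `0`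
stands for no coin. -/
theorem nimSum_singleton {s : Finset ℕ} {x : ℕ} (hx : x ∈ s ∨ x = 0) :
    nimSum s (fun k => k = x) = x := by
  classical
  have key : ∀ t : Finset ℕ, nimSum t (fun k => k = x) = if x ∈ t then x else 0 := by
    intro t
    induction t using Finset.induction_on with
    | empty => simp [nimSum]
    | insert a t ha ih =>
      unfold nimSum at ih ⊢
      rw [Finset.fold_insert ha, ih]
      by_cases h : a = x
      · subst h
        simp [ha]
      · have h' : x ≠ a := fun e => h e.symm
        simp [h, h']
  rw [key]
  split_ifs with h
  · rfl
  · exact (hx.resolve_left h).symm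

/-- Turning over `x` and `y` changes the nim-sum by `x ^^^ y`. -/
theorem nimSum_toggle {s : Finset ℕ} {P Q : ℕ → Prop} {x y : ℕ} (hx : x ∈ s ∨ x = 0)
    (hy : y ∈ s ∨ y = 0) (hxy : x ≠ y) (h : ∀ k ∈ s, k ≠ 0 → (Q k ↔ Xor (P k) (k = x ∨ k = y))) :
    nimSum s Q = nimSum s P ^^^ (x ^^^ y) := by
  classical
  conv_rhs => rw [← nimSum_singleton hx, ← nimSum_singleton hy]
  unfold nimSum
  rw [← Finset.fold_op_distrib (op := fun a b : ℕ => a ^^^ b),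
    ← Finset.fold_op_distrib (op := fun a b : ℕ => a ^^^ b)]
  refine Finset.fold_congr fun k hk => ?_
  rcases eq_or_ne k 0 with rfl | h0
  · simp
  · simp only [h k hk h0, Xor]
    by_cases h1 : P k <;> simp only [h1] <;> split_ifs <;> simp_all

/-- Below the nim-sum, every value is obtained by lowering one of the summands. -/
theorem exists_xor_lt_of_lt_fold {s : Finset ℕ} {f : ℕ → ℕ} {v : ℕ}
    (hv : v < s.fold (fun a b : ℕ => a ^^^ b) 0 f) :
    ∃ k ∈ s, f k ^^^ (s.fold (fun a b : ℕ => a ^^^ b) 0 f ^^^ v) < f k := by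
  classical
  induction s using Finset.induction_on generalizing v with
  | empty => simp at hv
  | insert a t ha ih =>
    rw [Finset.fold_insert ha] at hv ⊢
    rcases Nat.lt_xor_cases hv with h | h
    · refine ⟨a, Finset.mem_insert_self a t, ?_⟩
      convert h using 1
      rw [Nat.xor_assoc, Nat.xor_xor_cancel_left, Nat.xor_comm]
    · obtain ⟨k, hk, hlt⟩ := ih h
      refine ⟨k, Finset.mem_insert_of_mem hk, ?_⟩
      convert hlt using 2
      rw [Nat.xor_comm (f a), Nat.xor_assoc, Nat.xor_comm (f a)]

/-- Bouton's argument for Nim, with a heap lowered from `x` to `y` replaced by toggling `x` and `y`.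
A summand that can be lowered is nonzero, which forces `P x`. -/
theorem exists_turn_of_lt_nimSum {s : Finset ℕ} {P : ℕ → Prop} {v : ℕ} (hv : v < nimSum s P) :
    ∃ x ∈ s, P x ∧ ∃ y < x, nimSum s P ^^^ (x ^^^ y) = v := by
  classical
  obtain ⟨x, hx, hlt⟩ := exists_xor_lt_of_lt_fold hv
  by_cases hP : P x
  · rw [if_pos hP] at hlt
    refine ⟨x, hx, hP, _, hlt, ?_⟩
    change nimSum s P ^^^ (x ^^^ (x ^^^ (nimSum s P ^^^ v))) = v
    rw [Nat.xor_xor_cancel_left, Nat.xor_xor_cancel_left]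
  · rw [if_neg hP] at hlt
    exact absurd hlt (Nat.not_lt_zero _)

/-! ### The value of a balanced position -/

namespace YoungDiagram

/-- The nim-sum of the `x ∈ {1, …, n}` for which the step at distance `x` to the right of the
middle is vertical. -/
noncomputable def balancedValue (n δ : ℕ) (Y : YoungDiagram) : ℕ :=
  nimSum (Finset.Icc 1 n) fun x => (x : ℤ) + δ ∈ Y.edges

variable {n δ : ℕ} {Y Z : YoungDiagram} {q p : ℤ}

/-- The distance from the middle of the boundary path, and `0` for the middle step itself. -/
def middleDist (δ : ℕ) (k : ℤ) : ℕ := if k ≤ 0 then (1 - k).toNat else (k - δ).toNat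

/-- A step and its mirror image are at the same distance from the middle. -/
theorem middleDist_eq_iff (hδ : δ ≤ 1) {k l : ℤ} :
    middleDist δ k = middleDist δ l ↔ k = l ∨ k = 1 + δ - l := by
  unfold middleDist
  split_ifs <;> omega

/-- The coins toggled are those at the distances of `p` and `q`. For a self-mirror hook these are
the same coin, toggled once, hence `y = 0`. -/
theorem IsBalanced.balancedValue_swapEdges (hY : Y.IsBalanced n δ) (hδ : δ ≤ 1)
    (hq : q ∉ Y.edges) (hp : p ∈ Y.edges) (hqp : q < p)
    (hZ : Z.edges = swapEdges δ Y.edges q p) :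
    ∃ x y : ℕ, x ≠ y ∧ balancedValue n δ Z = balancedValue n δ Y ^^^ (x ^^^ y) ∧
      (x = middleDist δ p ∧ y = if q + p = 1 + δ then 0 else middleDist δ q) := by
  have h1 := hY.le_of_mem p hp
  have h2 := hY.le_of_notMem hq
  have hpm : p ≠ 1 + δ - p := fun h => hY.reflect_notMem p hp (h ▸ hp)
  have hx0 : middleDist δ p ≠ 0 := by
    unfold middleDist
    split_ifs <;> omega
  have hxn : middleDist δ p ≤ n := by
    unfold middleDist
    split_ifs <;> omega
  have hyn : middleDist δ q ≤ n := by
    unfold middleDist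
    split_ifs <;> omega
  have hne : middleDist δ p ≠ if q + p = 1 + δ then 0 else middleDist δ q := by
    split_ifs with hs
    · exact hx0
    · rw [Ne, middleDist_eq_iff hδ]
      omega
  refine ⟨_, _, hne, ?_, rfl, rfl⟩
  refine nimSum_toggle ?_ ?_ hne fun z hz hz0 => ?_
  · rw [Finset.mem_Icc]
    omega
  · rw [Finset.mem_Icc]
    split_ifs <;> omega
  · have hzm : middleDist δ (z + δ) = z := by
      unfold middleDist
      split_ifs <;> omega
    have ep : z = middleDist δ p ↔ (z : ℤ) + δ = p ∨ (z : ℤ) + δ = 1 + δ - p := by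
      rw [← middleDist_eq_iff hδ, hzm]
    have eq : z = middleDist δ q ↔ (z : ℤ) + δ = q ∨ (z : ℤ) + δ = 1 + δ - q := by
      rw [← middleDist_eq_iff hδ, hzm]
    -- At `p` and the mirror of `q` heads become tails; at `q` and the mirror of `p` the reverse.
    -- Since `z ≠ 0`, the middle step does not interfere.
    have cp : (z : ℤ) + δ = p → (z : ℤ) + δ ∈ Y.edges := fun h => h ▸ hp
    have cp' : (z : ℤ) + δ = 1 + δ - p → (z : ℤ) + δ ∉ Y.edges :=
      fun h => h ▸ hY.reflect_notMem p hp
    have cq : (z : ℤ) + δ = q → (z : ℤ) + δ ∉ Y.edges := fun h => h ▸ hq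
    have cq' : (z : ℤ) + δ = 1 + δ - q → (z : ℤ) + δ ∈ Y.edges :=
      fun h => h ▸ hY.reflect_mem q hq (by omega)
    rw [hZ, mem_swapEdges]
    by_cases hk : (z : ℤ) + δ ∈ Y.edges
    · simp only [hk, not_true, imp_false, true_and, xor_true] at cp' cq ⊢
      split_ifs <;> omega
    · simp only [hk, imp_false, false_and, or_false, xor_false, id] at cp cq' ⊢
      split_ifs <;> omega

/-- Turning over `x` and a smaller `y` (or `x` alone, when `y = 0`) is a move. -/
theorem IsBalanced.exists_move_turn (hY : Y.IsBalanced n δ) (hδ : δ ≤ 1) {x y : ℕ} (hyx : y < x)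
    (hx : (x : ℤ) + δ ∈ Y.edges) :
    ∃ Z, MHRGMove (unimodalNumbering n (n + δ)) Y Z ∧
      balancedValue n δ Z = balancedValue n δ Y ^^^ (x ^^^ y) := by
  have hxm : middleDist δ (x + δ) = x := by
    unfold middleDist
    split_ifs <;> omega
  have key : ∀ q : ℤ, q ∉ Y.edges → q < x + δ →
      (y = if q + (x + δ) = 1 + δ then 0 else middleDist δ q) →
      ∃ Z, MHRGMove (unimodalNumbering n (n + δ)) Y Z ∧
        balancedValue n δ Z = balancedValue n δ Y ^^^ (x ^^^ y) := by
    intro q hq hqp hy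
    obtain ⟨Z, hZ, hE⟩ := hY.exists_move hq hx hqp
    obtain ⟨x', y', -, hv, hx', hy'⟩ := hY.balancedValue_swapEdges hδ hq hx hqp hE
    rw [hxm] at hx'
    rw [← hy] at hy'
    exact ⟨Z, hZ, by rw [hv, hx', hy']⟩
  -- With `p = x + δ`, the step `q` is the mirror of `p` if `y = 0`; otherwise it is whichever of `y
  -- + δ` and its mirror image `1 - y` is horizontal.
  rcases Nat.eq_zero_or_pos y with h0 | h0
  · refine key (1 - x) (fun h => hY.reflect_notMem _ h ?_) (by omega) (by rw [if_pos (by ring), h0])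
    convert hx using 1
    ring
  by_cases hy : (y : ℤ) + δ ∈ Y.edges
  · refine key (1 - y) (fun h => hY.reflect_notMem _ h ?_) (by omega) ?_
    · convert hy using 1
      ring
    · rw [if_neg (by omega)]
      unfold middleDist
      split_ifs <;> omega
  · refine key (y + δ) hy (by omega) ?_
    rw [if_neg (by omega)]
    unfold middleDist
    split_ifs <;> omega

/-! ### The starting position -/

theorem mem_edges_rect (m n : ℕ) {k : ℤ} :
    k ∈ (rect m n).edges ↔ (n - m < k ∧ k ≤ n) ∨ k ≤ -m := by
  have hrow : ∀ i, (rect m n).rowLen i = if i < m then n else 0 := by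
    intro i
    refine eq_of_forall_lt_iff fun j => ?_
    rw [← mem_iff_lt_rowLen, ← mem_cells]
    simp only [rect, Finset.mem_product, Finset.mem_range]
    split_ifs <;> omega
  simp only [edges, Set.mem_range, hrow]
  constructor
  · rintro ⟨i, rfl⟩
    split_ifs <;> omega
  · rintro (h | h)
    · exact ⟨(n - k).toNat, by rw [if_pos (by omega)]; omega⟩
    · exact ⟨(-k).toNat, by rw [if_neg (by omega)]; omega⟩

/-- The steps `1, …, δ` are horizontal and reflected among themselves, so at most one of them, the
middle one, is allowed. -/
theorem isBalanced_rect (hδ : δ ≤ 1) : (rect n (n + δ)).IsBalanced n δ := by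
  refine ⟨fun k hk => ?_, fun k hk => ?_, fun k hk h2 => ?_⟩ <;>
    rw [mem_edges_rect] at * <;> push_cast at * <;> omega

theorem balancedValue_rect : balancedValue n δ (rect n (n + δ)) = nimSumUpTo n := by
  classical
  unfold balancedValue nimSum nimSumUpTo
  refine Finset.fold_congr (op := fun a b : ℕ => a ^^^ b) fun k hk => if_pos ?_
  beta_reduce
  rw [mem_edges_rect]
  rw [Finset.mem_Icc] at hk
  push_cast
  omega

end YoungDiagram

/-! ### The Sprague–Grundy induction -/

theorem mex_eq_of_forall {T : Set ℕ} {v : ℕ} (hv : v ∉ T) (h : ∀ w < v, w ∈ T) : mex T = v := by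
  refine le_antisymm (Nat.sInf_le hv) (le_of_not_gt fun hlt => ?_)
  exact Nat.sInf_mem (s := Tᶜ) ⟨v, hv⟩ (h _ hlt)

open YoungDiagram in
theorem grundy_eq_balancedValue {n δ : ℕ} (hδ : δ ≤ 1) (P : (rectMHRG n (n + δ)).Pos)
    (hP : P.1.IsBalanced n δ) :
    (rectMHRG n (n + δ)).grundy P = balancedValue n δ P.1 := by
  induction hc : P.1.card using Nat.strong_induction_on generalizing P with
  | _ N ih =>
    have step : ∀ Q : (rectMHRG n (n + δ)).Pos, (rectMHRG n (n + δ)).Move P Q →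
        (rectMHRG n (n + δ)).grundy Q = balancedValue n δ Q.1 ∧
          balancedValue n δ Q.1 ≠ balancedValue n δ P.1 := by
      intro Q hQ
      have hlt : Q.1.card < N :=
        hc ▸ Finset.card_lt_card (cells_ssubset_iff.2 (MHRGMove.lt hQ))
      obtain ⟨q, p, hq, hp, hqp, hE⟩ := hP.edges_of_move hQ
      refine ⟨ih _ hlt Q (hP.swapEdges_balanced hq hp hqp hE) rfl, ?_⟩
      obtain ⟨x, y, hxy, hv, -⟩ := hP.balancedValue_swapEdges hδ hq hp hqp hE
      rw [hv]
      intro h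
      -- Cancelling the old value would leave `x ^^^ y = 0`, although `x ≠ y`.
      have h' := congrArg (fun t => balancedValue n δ P.1 ^^^ t) h
      simp only [Nat.xor_xor_cancel_left, Nat.xor_self] at h'
      exact hxy (Nat.xor_eq_zero_iff.1 h')
    rw [ImpartialGame.grundy]
    refine mex_eq_of_forall ?_ fun w hw => ?_
    · rintro ⟨⟨Q, hQ⟩, he⟩
      exact (step Q hQ).2 ((step Q hQ).1.symm.trans he)
    · obtain ⟨x, -, hx, y, hyx, hv⟩ := exists_turn_of_lt_nimSum hw
      obtain ⟨Z, hZ, hE⟩ := hP.exists_move_turn hδ hyx hx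
      have hM : (rectMHRG n (n + δ)).Move P ⟨Z, P.2.tail hZ⟩ := hZ
      exact ⟨⟨⟨Z, P.2.tail hZ⟩, hM⟩, (step _ hM).1.trans (hE.trans hv)⟩

theorem grundy_start_rectMHRG {n δ : ℕ} (hδ : δ ≤ 1) :
    (rectMHRG n (n + δ)).grundy (rectMHRG n (n + δ)).start = nimSumUpTo n :=
  (grundy_eq_balancedValue hδ _ (YoungDiagram.isBalanced_rect hδ)).trans
    YoungDiagram.balancedValue_rect

theorem corollary5p16 (n : ℕ) (hn : 1 ≤ n) :
    (rectMHRG n n).grundy (rectMHRG n n).start = nimSumUpTo n ∧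
      (rectMHRG n (n + 1)).grundy (rectMHRG n (n + 1)).start = nimSumUpTo n :=
  ⟨grundy_start_rectMHRG (δ := 0) (by omega), grundy_start_rectMHRG (δ := 1) le_rfl⟩
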